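/- Let $k$ be an algebraically closed field of characteristic different from $2$, $3$ and $5$, let $S = k[[x,y]]$, and let $k[[X]]$ be the power series ring in one variable. For a ring $A$ write $A^*$ for its group of units, and for a group $G$ write $G_{\mathrm{ab}}$ for its abelianization. If $g$ divides $f$ in $S$, regard $S/gS$ as a module over $S/fS$ through the canonical surjection $S/fS \to S/gS$. (a) Let $n \geq 1$, let $R = S/\big((x-y^n)(x+y^n)\big)$ be the one-dimensional singularity $A_{2n-1}$, and let $L$ be the $R$-module $S/(x-y^n) \oplus R$. Then $$\mathrm{Aut}_R(L)_{\mathrm{ab}} \;\cong\; \big(S/(x-y^n)\big)^* \oplus \big(S/(x+y^n)\big)^* \;\cong\; (k[[X]]^*)^{\oplus 2}.$$ (b) Let $n \geq 2$, let $R = S/\big((x-y^{n-1})\,y\,(x+y^{n-1})\big)$ be the one-dimensional singularity $D_{2n}$, and let $L$ be the $R$-module $S/(x-y^{n-1}) \oplus S/\big((x-y^{n-1})y\big) \oplus R$. Then $$\mathrm{Aut}_R(L)_{\mathrm{ab}} \;\cong\; \big(S/(x-y^{n-1})\big)^* \oplus \big(S/(y)\big)^* \oplus \big(S/(x+y^{n-1})\big)^*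 \;\cong\; (k[[X]]^*)^{\oplus 3}.$$ -/

import Mathlib

noncomputable section

namespace PlaneCurve

/-- The formal power series ring `k[[x, y]]`. -/
abbrev PS (k : Type*) [Field k] : Type _ := MvPowerSeries (Fin 2) k

variable (k : Type*) [Field k]

/-- The variable `x` of `k[[x, y]]`. -/
abbrev x : PS k := MvPowerSeries.X 0

/-- The variable `y` of `k[[x, y]]`. -/
abbrev y : PS k := MvPowerSeries.X 1

variable {k}

/-- The quotient ring `S/fS`, where `S = k[[x, y]]`. -/
abbrev Quo (f : PS k) : Type _ := PS k ⧸ Ideal.span {f}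

theorem span_le_of_dvd {f g : PS k} (h : g ∣ f) :
    (Ideal.span {f} : Ideal (PS k)) ≤ Ideal.span {g} :=
  Ideal.span_singleton_le_span_singleton.mpr h

/-- For `g ∣ f`, the additive group `S/gS`, to be regarded as a module over `S/fS`. -/
def QuoMod (f g : PS k) (_h : g ∣ f) : Type _ := Quo g

instance (f g : PS k) (h : g ∣ f) : AddCommGroup (QuoMod f g h) :=
  inferInstanceAs (AddCommGroup (Quo g))

/-- `S/fS` acts on `S/gS` through the canonical surjection `S/fS → S/gS`. -/
instance (f g : PS k) (h : g ∣ f) : Module (Quo f) (QuoMod f g h) :=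
  Module.compHom (Quo g) (Ideal.Quotient.factor (span_le_of_dvd h))

variable (k)

/-- The equation `(x - y^n)(x + y^n)` of the one-dimensional singularity `A_{2n-1}`. -/
abbrev eqA (n : ℕ) : PS k := (x k - y k ^ n) * (x k + y k ^ n)

/-- The ring `R = S/((x - y^n)(x + y^n))` of the one-dimensional singularity `A_{2n-1}`. -/
abbrev RA (n : ℕ) : Type _ := Quo (eqA k n)

/-- The `R`-module `S/(x - y^n) ⊕ R`, for `R` of type `A_{2n-1}`. -/
abbrev LA (n : ℕ) : Type _ :=
  QuoMod (eqA k n) (x k - y k ^ n) (dvd_mul_right _ _) × RA k n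

/-- The equation `(x - y^(n-1)) y (x + y^(n-1))` of the one-dimensional singularity `D_{2n}`
(used for `n ≥ 2`). -/
abbrev eqD (n : ℕ) : PS k := (x k - y k ^ (n - 1)) * y k * (x k + y k ^ (n - 1))

/-- The ring `R = S/((x - y^(n-1)) y (x + y^(n-1)))` of the one-dimensional singularity
`D_{2n}`. -/
abbrev RD (n : ℕ) : Type _ := Quo (eqD k n)

/-- The `R`-module `S/(x - y^(n-1)) ⊕ S/((x - y^(n-1)) y) ⊕ R`, for `R` of type `D_{2n}`. -/
abbrev LD (n : ℕ) : Type _ :=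
  QuoMod (eqD k n) (x k - y k ^ (n - 1)) ((dvd_mul_right _ _).mul_right _) ×
    QuoMod (eqD k n) ((x k - y k ^ (n - 1)) * y k) (dvd_mul_right _ _) × RD k n

end PlaneCurve

/-- `Aut_A(M)_ab`, the abelianization of the group of `A`-linear automorphisms of `M`. -/
abbrev AutAb (A M : Type*) [Ring A] [AddCommGroup M] [Module A M] : Type _ :=
  Abelianization (M ≃ₗ[A] M)

end

/-!
Both parts are instances of one statement (`nonempty_autAb_mulEquiv`). Let `S` be a local domain
whose residue field has more than two elements, let `f₀, …, fₙ` be nonzero non-units of `S`, put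
`gᵢ = f₀⋯fᵢ`, and let `M = ⊕ S/gᵢS`. Then `Aut(M)_ab ≅ ∏ (S/fᵢS)ˣ`.

The endomorphisms of `M` are induced by the matrices over `S` that preserve `⊕ gᵢS`; these form an
algebra `latticeOrder`, and all automorphisms lift to its units, because a matrix congruent to the
identity modulo the `gᵢ` is invertible. Such a matrix becomes block triangular modulo `f_j`, with a
diagonal block formed by the indices `≥ j`, and the determinants of these blocks define a surjection
`cornerDet` from the unit group onto `∏ (S/f_jS)ˣ`, which factors through `Aut(M)`.

It remains to see that the kernel dies in the abelianization. Choose a unit `u` with `u - 1`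
invertible. Conjugation by diagonal matrices with entries `1` and `u` shows that off-diagonal row
and column operations are commutators. The diagonal entries of a unit are units, since modulo the
maximal ideal the matrices are upper triangular; so Gaussian elimination reduces every unit to a
diagonal one. Write `[s]_j` for the class of the diagonal matrix with `s` in position `j` and `1`
elsewhere. Whitehead's relation (`map_one_add_mul_comm`) between `1 + ef` and `1 + fe` gives
`[s]_{j+1} = [s]_j` whenever `s ≡ 1` modulo `f_{j+1}`. If `diag(s₀, …, sₙ)` has trivial
determinants, that is, `s_j⋯s_n ≡ 1` modulo `f_j` for all `j`, then moving the last factor step by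
step to the front turns its class into `[s₀⋯sₙ]₀`, which is trivial on `M` as `g₀ = f₀`.

For the identification with power series rings, the substitution `x ↦ x + cyⁿ` is an automorphism
of `k[[x, y]]`, so that `k[[x, y]]/(x + cyⁿ) ≅ k[[x, y]]/(x) ≅ k[[X]]`.
-/

section

open Finset Matrix

/-! ### Telescoping products over `Fin n` -/

/-- Every family `t` in a commutative group is the family of tail products `s_j s_{j+1} ⋯` of some
family `s`. -/
theorem Fin.exists_prod_Ici_eq {G : Type*} [CommGroup G] :
    ∀ {n : ℕ} (t : Fin n → G), ∃ s : Fin n → G, ∀ j, ∏ a ∈ Ici j, s a = t j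
  | 0, _ => ⟨fun _ => 1, fun j => j.elim0⟩
  | n + 1, t => by
    obtain ⟨s, hs⟩ := Fin.exists_prod_Ici_eq (fun j : Fin n => t j.succ)
    refine ⟨Fin.cons (t 0 / ∏ a, s a) s, fun j => ?_⟩
    refine Fin.cases ?_ (fun j => ?_) j
    · have : Ici (0 : Fin (n + 1)) = univ := by ext; simp
      rw [this, Fin.prod_univ_succ]
      simp
    · rw [Fin.prod_Ici_succ]
      simpa using hs j

/-- If `h_{j+1}` and `h_j` agree at the tail product `s_{j+1} s_{j+2} ⋯` for all `j`, then in
`∏ hᵢ(sᵢ)` all factors can be moved, starting from the last one, to the position `0`. -/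
theorem Fin.prod_hom_eq_hom_zero_prod {G Q : Type*} [CommGroup G] [CommGroup Q] :
    ∀ {n : ℕ} (h : Fin (n + 1) → G →* Q) (s : Fin (n + 1) → G),
      (∀ j : Fin n, h j.succ (∏ a ∈ Ici j.succ, s a) = h j.castSucc (∏ a ∈ Ici j.succ, s a)) →
      ∏ i, h i (s i) = h 0 (∏ i, s i)
  | 0, h, s, _ => by simp
  | n + 1, h, s, H => by
    have ih := Fin.prod_hom_eq_hom_zero_prod (fun i => h i.succ) (fun i => s i.succ) (fun j => by
      have := H j.succ
      rwa [Fin.prod_Ici_succ, ← Fin.succ_castSucc] at this)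
    have h0 := H 0
    have : Ici (0 : Fin (n + 1)) = univ := by ext; simp
    rw [Fin.prod_Ici_succ, this] at h0
    rw [Fin.prod_univ_succ, ih, h0, Fin.prod_univ_succ s, map_mul]
    rfl

/-! ### Homomorphisms from unit groups to commutative groups -/

/-- The unit `1 + e`, for `e` of square zero. -/
@[simps]
def unitOneAdd {A : Type*} [Ring A] (e : A) (he : e * e = 0) : Aˣ where
  val := 1 + e
  inv := 1 - e
  val_inv := by simp [mul_sub, add_mul, he]
  inv_val := by simp [mul_add, sub_mul, he]

/-- If conjugation by a unit `d` multiplies the square-zero element `e` by a scalar `c` such that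
`c - 1` is invertible, then `1 + e` is a commutator. -/
theorem map_unitOneAdd_eq_one {S A Q : Type*} [CommRing S] [Ring A] [Algebra S A] [CommGroup Q]
    (π : Aˣ →* Q) {e : A} (he : e * e = 0) (d : Aˣ) {c : S} (hc : IsUnit (c - 1))
    (hd : d * e = c • (e * d)) : π (unitOneAdd e he) = 1 := by
  obtain ⟨w, hw⟩ := hc
  -- `d (1 + e') d⁻¹ = 1 + c e' = (1 + e') (1 + (c - 1) e')`, so `e' = (c - 1)⁻¹ e` does it.
  have he' : ((↑w⁻¹ : S) • e) * ((↑w⁻¹ : S) • e) = 0 := by simp [he]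
  have key : d * unitOneAdd _ he' = unitOneAdd _ he' * unitOneAdd e he * d := by
    ext
    have hcw : c * (↑w⁻¹ : S) = (↑w⁻¹ : S) + 1 := by
      have : c = w + 1 := by rw [hw]; ring
      rw [this, add_mul, Units.mul_inv, one_mul, add_comm]
    simp only [Units.val_mul, val_unitOneAdd, mul_add, add_mul, mul_one, one_mul,
      smul_mul_assoc, mul_smul_comm, he, hd, smul_zero, add_zero]
    rw [smul_smul, mul_comm, hcw, add_smul, one_smul]
    abel
  have := congrArg π key
  rw [map_mul, map_mul, map_mul, mul_comm] at this
  simpa [mul_assoc, mul_comm] using this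

/-- Whitehead's relation: homomorphisms to commutative groups take the same value at `1 + ef` and
at `1 + fe`, if `e` and `f` have square zero. -/
theorem map_one_add_mul_comm {A Q : Type*} [Ring A] [CommGroup Q] (π : Aˣ →* Q) {e f : A}
    (he : e * e = 0) (hf : f * f = 0) (p q : Aˣ) (hp : (p : A) = 1 + e * f)
    (hq : (q : A) = 1 + f * e) : π p = π q := by
  have hff : ∀ z, f * (f * z) = 0 := fun z => by rw [← mul_assoc, hf, zero_mul]
  have key : unitOneAdd e he * unitOneAdd f hf * q = p * unitOneAdd f hf * unitOneAdd e he := by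
    ext
    simp only [Units.val_mul, val_unitOneAdd, hp, hq, mul_add, add_mul, mul_one, one_mul,
      mul_assoc, hf, hff, mul_zero]
    abel
  have := congrArg π key
  simp only [map_mul] at this
  rw [mul_comm, mul_assoc (π p), mul_comm (π (unitOneAdd f hf))] at this
  exact (mul_right_cancel this).symm

/-- A homomorphism `D` to a commutative group identifies the abelianization of a quotient `G` of `U`
if it factors through `G` and its kernel is killed in the abelianization of `G`. -/
theorem nonempty_abelianization_mulEquiv {U G P : Type*} [Group U] [Group G] [CommGroup P]
    (φ : U →* G) (D : U →* P) (hφ : Function.Surjective φ) (hD : Function.Surjective D)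
    (hker : φ.ker ≤ D.ker) (hcomm : ∀ u, D u = 1 → Abelianization.of (φ u) = 1) :
    Nonempty (Abelianization G ≃* P) := by
  let D' : G →* P := φ.liftOfSurjective hφ ⟨D, hker⟩
  have hD' : ∀ u, D' (φ u) = D u := fun u => φ.liftOfRightInverse_comp_apply _ _ ⟨D, hker⟩ u
  refine ⟨MulEquiv.ofBijective (Abelianization.lift D') ⟨?_, fun p => ?_⟩⟩
  · rw [injective_iff_map_eq_one]
    intro a
    obtain ⟨g, rfl⟩ := QuotientGroup.mk_surjective a
    obtain ⟨u, rfl⟩ := hφ g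
    change Abelianization.lift D' (Abelianization.of (φ u)) = 1 → _
    rw [Abelianization.lift_apply_of, hD']
    exact hcomm u
  · obtain ⟨u, rfl⟩ := hD p
    exact ⟨Abelianization.of (φ u), by rw [Abelianization.lift_apply_of, hD']⟩

/-! ### The order of matrices preserving a diagonal lattice -/

theorem mul_self_eq_zero_of_col {S ι : Type*} [CommRing S] [Fintype ι] {p : ι} {e : Matrix ι ι S}
    (hcol : ∀ a b, b ≠ p → e a b = 0) (hdiag : e p p = 0) : e * e = 0 := by
  ext a b
  rw [Matrix.mul_apply]
  refine Finset.sum_eq_zero fun c _ => ?_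
  rcases eq_or_ne c p with rfl | hc
  · rcases eq_or_ne b c with rfl | hb
    · rw [hdiag, mul_zero]
    · rw [hcol c b hb, mul_zero]
  · rw [hcol a c hc, zero_mul]

theorem mul_self_eq_zero_of_row {S ι : Type*} [CommRing S] [Fintype ι] {p : ι} {e : Matrix ι ι S}
    (hrow : ∀ a b, a ≠ p → e a b = 0) (hdiag : e p p = 0) : e * e = 0 := by
  ext a b
  rw [Matrix.mul_apply]
  refine Finset.sum_eq_zero fun c _ => ?_
  rcases eq_or_ne c p with rfl | hc
  · rcases eq_or_ne a c with rfl | ha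
    · rw [hdiag, zero_mul]
    · rw [hrow a c ha, zero_mul]
  · rw [hrow c b hc, mul_zero]

section Order

variable {S ι : Type*} [CommRing S] [Fintype ι] [DecidableEq ι]

/-- The algebra of square matrices `A` over `S` such that `A` maps the submodule `⊕ gᵢS` of the
free module `S^ι` to itself. -/
def latticeOrder (g : ι → S) : Subalgebra S (Matrix ι ι S) where
  carrier := {A | ∀ i j, g i ∣ A i j * g j}
  mul_mem' {A B} hA hB i j := by
    rw [Matrix.mul_apply, Finset.sum_mul]
    refine Finset.dvd_sum fun k _ => ?_
    obtain ⟨c, hc⟩ := hB k j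
    rw [mul_assoc, hc, ← mul_assoc]
    exact (hA i k).mul_right c
  add_mem' hA hB i j := by
    rw [Matrix.add_apply, add_mul]
    exact dvd_add (hA i j) (hB i j)
  algebraMap_mem' s i j := by
    rw [Matrix.algebraMap_matrix_apply]
    split_ifs with h
    · subst h
      exact dvd_mul_left _ _
    · simp

variable {g : ι → S}

theorem mem_latticeOrder {A : Matrix ι ι S} :
    A ∈ latticeOrder g ↔ ∀ i j, g i ∣ A i j * g j := Iff.rfl

theorem diagonal_mem_latticeOrder (s : ι → S) : diagonal s ∈ latticeOrder g := by
  intro i j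
  rcases eq_or_ne i j with rfl | h
  · exact dvd_mul_left _ _
  · simp [diagonal_apply_ne _ h]

variable (g) in
/-- The diagonal matrices with invertible entries, as units of the order. -/
def diagonalUnits : (ι → Sˣ) →* (latticeOrder g)ˣ where
  toFun s :=
    { val := ⟨diagonal fun i => (s i : S), diagonal_mem_latticeOrder _⟩
      inv := ⟨diagonal fun i => (↑(s i)⁻¹ : S), diagonal_mem_latticeOrder _⟩
      val_inv := by ext1; simp [diagonal_mul_diagonal]
      inv_val := by ext1; simp [diagonal_mul_diagonal] }
  map_one' := by ext1; ext1; simp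
  map_mul' s t := by ext1; ext1; simp [diagonal_mul_diagonal]

@[simp]
theorem coe_diagonalUnits (s : ι → Sˣ) :
    ((diagonalUnits g s : latticeOrder g) : Matrix ι ι S) = diagonal fun i => (s i : S) := rfl

theorem map_diagonalUnits {Q : Type*} [CommGroup Q] (π : (latticeOrder g)ˣ →* Q) (s : ι → Sˣ) :
    π (diagonalUnits g s) = ∏ i, π (diagonalUnits g (Pi.mulSingle i (s i))) := by
  have := map_prod (π.comp (diagonalUnits g)) (fun i => Pi.mulSingle i (s i)) univ
  rwa [Finset.univ_prod_mulSingle] at this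

/-- The elements `1 + e` of the order, where `e` is supported on the off-diagonal part of the
`p`-th column, are killed by all homomorphisms to commutative groups. -/
theorem map_unitOneAdd_of_col {Q : Type*} [CommGroup Q] (π : (latticeOrder g)ˣ →* Q) {u : Sˣ}
    (hu : IsUnit ((u : S) - 1)) (p : ι) {e : latticeOrder g} (he : e * e = 0)
    (hcol : ∀ a b, b ≠ p → (e : Matrix ι ι S) a b = 0) (hdiag : (e : Matrix ι ι S) p p = 0) :
    π (unitOneAdd e he) = 1 := by
  refine map_unitOneAdd_eq_one π he (diagonalUnits g (Pi.mulSingle p u⁻¹)) hu ?_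
  ext a b
  simp only [MulMemClass.coe_mul, coe_diagonalUnits, diagonal_mul, SetLike.val_smul, Matrix.smul_apply,
    mul_diagonal, smul_eq_mul]
  rcases eq_or_ne b p with rfl | hb
  · rcases eq_or_ne a b with rfl | ha
    · simp [hdiag]
    · simp [Pi.mulSingle_eq_of_ne ha, mul_comm (e.1 a b)]
  · simp [hcol a b hb]

/-- The elements `1 + e` of the order, where `e` is supported on the off-diagonal part of the
`p`-th row, are killed by all homomorphisms to commutative groups. -/
theorem map_unitOneAdd_of_row {Q : Type*} [CommGroup Q] (π : (latticeOrder g)ˣ →* Q) {u : Sˣ}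
    (hu : IsUnit ((u : S) - 1)) (p : ι) {e : latticeOrder g} (he : e * e = 0)
    (hrow : ∀ a b, a ≠ p → (e : Matrix ι ι S) a b = 0) (hdiag : (e : Matrix ι ι S) p p = 0) :
    π (unitOneAdd e he) = 1 := by
  refine map_unitOneAdd_eq_one π he (diagonalUnits g (Pi.mulSingle p u)) hu ?_
  ext a b
  simp only [MulMemClass.coe_mul, coe_diagonalUnits, diagonal_mul, SetLike.val_smul, Matrix.smul_apply,
    mul_diagonal, smul_eq_mul]
  rcases eq_or_ne a p with rfl | ha
  · rcases eq_or_ne b a with rfl | hb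
    · simp [hdiag]
    · simp [Pi.mulSingle_eq_of_ne hb]
  · simp [hrow a b ha]

/-- Clearing the off-diagonal entries of the `p`-th column with the pivot `A p p`. -/
theorem exists_clear_col {Q : Type*} [CommGroup Q] (π : (latticeOrder g)ˣ →* Q) {u : Sˣ}
    (hu : IsUnit ((u : S) - 1)) (A : (latticeOrder g)ˣ) (p : ι)
    (hA : IsUnit (((A : latticeOrder g) : Matrix ι ι S) p p)) :
    ∃ B : (latticeOrder g)ˣ, π B = π A ∧ ∃ v : ι → S, v p = 0 ∧
      (∀ a, a ≠ p → (A : latticeOrder g).1 a p = 0 → v a = 0) ∧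
      (∀ a, a ≠ p → (B : latticeOrder g).1 a p = 0) ∧
      ∀ a b, (B : latticeOrder g).1 a b =
        (A : latticeOrder g).1 a b + v a * (A : latticeOrder g).1 p b := by
  obtain ⟨w, hw⟩ := hA
  let v : ι → S := fun a => if a = p then 0 else -((A : latticeOrder g).1 a p * ↑w⁻¹)
  have hvp : v p = 0 := if_pos rfl
  have hv : ∀ a, a ≠ p → v a = -((A : latticeOrder g).1 a p * ↑w⁻¹) := fun a ha => if_neg ha
  let e : Matrix ι ι S := of fun a b => if b = p then v a else 0
  have hcol : ∀ a b, b ≠ p → e a b = 0 := fun a b hb => if_neg hb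
  have hep : ∀ a, e a p = v a := fun a => if_pos rfl
  have hmem : e ∈ latticeOrder g := by
    intro a b
    rcases eq_or_ne b p with rfl | hb
    · rw [hep]
      rcases eq_or_ne a b with rfl | ha
      · simp [hvp]
      · rw [hv a ha, neg_mul, dvd_neg, mul_right_comm]
        exact ((A : latticeOrder g).2 a b).mul_right _
    · simp [hcol a b hb]
  have hee : (⟨e, hmem⟩ : latticeOrder g) * ⟨e, hmem⟩ = 0 :=
    Subtype.ext (mul_self_eq_zero_of_col hcol ((hep p).trans hvp))
  have hB : ∀ a b, ((unitOneAdd _ hee * A : (latticeOrder g)ˣ) : latticeOrder g).1 a b =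
      (A : latticeOrder g).1 a b + v a * (A : latticeOrder g).1 p b := by
    intro a b
    have : (e * (A : latticeOrder g).1) a b = v a * (A : latticeOrder g).1 p b := by
      rw [Matrix.mul_apply, Finset.sum_eq_single p, hep]
      · intro c _ hc
        rw [hcol a c hc, zero_mul]
      · simp
    rw [← this, ← Matrix.add_apply, Units.val_mul, val_unitOneAdd, add_mul, one_mul]
    rfl
  refine ⟨unitOneAdd _ hee * A, ?_, v, hvp, ?_, ?_, hB⟩
  · rw [map_mul, map_unitOneAdd_of_col π hu p hee hcol ((hep p).trans hvp), one_mul]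
  · intro a ha h
    rw [hv a ha, h, zero_mul, neg_zero]
  · intro a ha
    rw [hB, hv a ha, ← hw, neg_mul, mul_assoc, Units.inv_mul, mul_one, add_neg_cancel]

/-- Clearing the off-diagonal entries of the `p`-th row with the pivot `A p p`. -/
theorem exists_clear_row {Q : Type*} [CommGroup Q] (π : (latticeOrder g)ˣ →* Q) {u : Sˣ}
    (hu : IsUnit ((u : S) - 1)) (A : (latticeOrder g)ˣ) (p : ι)
    (hA : IsUnit (((A : latticeOrder g) : Matrix ι ι S) p p)) :
    ∃ B : (latticeOrder g)ˣ, π B = π A ∧ ∃ v : ι → S, v p = 0 ∧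
      (∀ b, b ≠ p → (A : latticeOrder g).1 p b = 0 → v b = 0) ∧
      (∀ b, b ≠ p → (B : latticeOrder g).1 p b = 0) ∧
      ∀ a b, (B : latticeOrder g).1 a b =
        (A : latticeOrder g).1 a b + (A : latticeOrder g).1 a p * v b := by
  obtain ⟨w, hw⟩ := hA
  let v : ι → S := fun b => if b = p then 0 else -(↑w⁻¹ * (A : latticeOrder g).1 p b)
  have hvp : v p = 0 := if_pos rfl
  have hv : ∀ b, b ≠ p → v b = -(↑w⁻¹ * (A : latticeOrder g).1 p b) := fun b hb => if_neg hb
  let e : Matrix ι ι S := of fun a b => if a = p then v b else 0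
  have hrow : ∀ a b, a ≠ p → e a b = 0 := fun a b ha => if_neg ha
  have hep : ∀ b, e p b = v b := fun b => if_pos rfl
  have hmem : e ∈ latticeOrder g := by
    intro a b
    rcases eq_or_ne a p with rfl | ha
    · rw [hep]
      rcases eq_or_ne b a with rfl | hb
      · simp [hvp]
      · rw [hv b hb, neg_mul, dvd_neg, mul_assoc]
        exact ((A : latticeOrder g).2 a b).mul_left _
    · simp [hrow a b ha]
  have hee : (⟨e, hmem⟩ : latticeOrder g) * ⟨e, hmem⟩ = 0 :=
    Subtype.ext (mul_self_eq_zero_of_row hrow ((hep p).trans hvp))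
  have hB : ∀ a b, ((A * unitOneAdd _ hee : (latticeOrder g)ˣ) : latticeOrder g).1 a b =
      (A : latticeOrder g).1 a b + (A : latticeOrder g).1 a p * v b := by
    intro a b
    have : ((A : latticeOrder g).1 * e) a b = (A : latticeOrder g).1 a p * v b := by
      rw [Matrix.mul_apply, Finset.sum_eq_single p, hep]
      · intro c _ hc
        rw [hrow c b hc, mul_zero]
      · simp
    rw [← this, ← Matrix.add_apply, Units.val_mul, val_unitOneAdd, mul_add, mul_one]
    rfl
  refine ⟨A * unitOneAdd _ hee, ?_, v, hvp, ?_, ?_, hB⟩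
  · rw [map_mul, map_unitOneAdd_of_row π hu p hee hrow ((hep p).trans hvp), mul_one]
  · intro b hb h
    rw [hv b hb, h, mul_zero, neg_zero]
  · intro b hb
    rw [hB, hv b hb, ← hw, mul_neg, Units.mul_inv_cancel_left, add_neg_cancel]

/-- Gaussian elimination: if all units of the order have invertible diagonal entries, then a unit
agrees with a diagonal one in every commutative quotient of the unit group. -/
theorem exists_map_diagonalUnits_eq {Q : Type*} [CommGroup Q] (π : (latticeOrder g)ˣ →* Q) {u : Sˣ}
    (hu : IsUnit ((u : S) - 1))
    (hpiv : ∀ (A : (latticeOrder g)ˣ) (p : ι), IsUnit ((A : latticeOrder g).1 p p))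
    (A : (latticeOrder g)ˣ) :
    ∃ s : ι → Sˣ, π (diagonalUnits g s) = π A := by
  have key : ∀ t : Finset ι, ∃ B : (latticeOrder g)ˣ, π B = π A ∧ ∀ q ∈ t, ∀ a, a ≠ q →
      (B : latticeOrder g).1 a q = 0 ∧ (B : latticeOrder g).1 q a = 0 := by
    intro t
    induction t using Finset.induction_on with
    | empty => exact ⟨A, rfl, by simp⟩
    | insert p t hp ih =>
      obtain ⟨B, hBA, hB⟩ := ih
      obtain ⟨C, hCB, v, -, hv, hC, hCe⟩ := exists_clear_col π hu B p (hpiv B p)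
      obtain ⟨D, hDC, w, -, hw, hD, hDe⟩ := exists_clear_row π hu C p (hpiv C p)
      have hCt : ∀ q ∈ t, ∀ a, a ≠ q →
          (C : latticeOrder g).1 a q = 0 ∧ (C : latticeOrder g).1 q a = 0 := by
        intro q hq a ha
        have hpq : p ≠ q := fun h => hp (h ▸ hq)
        rw [hCe, hCe, (hB q hq a ha).1, (hB q hq a ha).2, (hB q hq p hpq).1,
          hv q hpq.symm (hB q hq p hpq).2]
        simp
      refine ⟨D, hDC.trans (hCB.trans hBA), fun q hq a ha => ?_⟩
      rcases Finset.mem_insert.mp hq with rfl | hq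
      · refine ⟨?_, hD a ha⟩
        rw [hDe, hC a ha, zero_mul, zero_add]
      · have hpq : p ≠ q := fun h => hp (h ▸ hq)
        rw [hDe, hDe, (hCt q hq a ha).1, (hCt q hq a ha).2, (hCt q hq p hpq).2,
          hw q hpq.symm (hCt q hq p hpq).1]
        simp
  obtain ⟨B, hBA, hB⟩ := key univ
  refine ⟨fun p => (hpiv B p).unit, ?_⟩
  rw [← hBA]
  congr 1
  ext a b
  rw [coe_diagonalUnits, diagonal_apply]
  split_ifs with h
  · subst h
    rfl
  · exact ((hB b (mem_univ b) a h).1).symm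

end Order

/-! ### The action of the order on the module -/

section Action

variable {S R M ι : Type*} [CommRing S] [Ring R] [AddCommGroup M] [Module R M] [Fintype ι]
  [DecidableEq ι] {ρ : S →+* R} {g : ι → S} {ψ : (ι → S) →ₛₗ[ρ] M}

theorem mulVec_dvd {A : Matrix ι ι S} (hA : A ∈ latticeOrder g) {v : ι → S}
    (hv : ∀ i, g i ∣ v i) (i : ι) : g i ∣ (A *ᵥ v) i := by
  refine Finset.dvd_sum fun j _ => ?_
  obtain ⟨c, hc⟩ := hv j
  rw [hc, ← mul_assoc]
  exact (hA i j).mul_right c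

theorem map_mulVec_eq_of_map_eq (hker : ∀ v, ψ v = 0 ↔ ∀ i, g i ∣ v i) {A : Matrix ι ι S}
    (hA : A ∈ latticeOrder g) {v w : ι → S} (h : ψ v = ψ w) : ψ (A *ᵥ v) = ψ (A *ᵥ w) := by
  rw [← sub_eq_zero, ← map_sub, hker] at h ⊢
  rw [← mulVec_sub]
  exact mulVec_dvd hA h

/-- The endomorphism of `M = S^ι / ⊕ gᵢS` induced by a matrix preserving `⊕ gᵢS`. -/
noncomputable def orderToEnd (hρ : Function.Surjective ρ) (hψ : Function.Surjective ψ)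
    (hker : ∀ v, ψ v = 0 ↔ ∀ i, g i ∣ v i) : latticeOrder g →* Module.End R M where
  toFun A :=
    -- The value does not depend on the preimage chosen by `surjInv`.
    { toFun := fun m => ψ (A.1 *ᵥ Function.surjInv hψ m)
      map_add' := fun m m' => by
        rw [← map_add, ← mulVec_add]
        apply map_mulVec_eq_of_map_eq hker A.2
        simp only [map_add, Function.surjInv_eq hψ]
      map_smul' := fun r m => by
        obtain ⟨s, rfl⟩ := hρ r
        rw [RingHom.id_apply, ← map_smulₛₗ, ← mulVec_smul]
        apply map_mulVec_eq_of_map_eq hker A.2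
        simp only [map_smulₛₗ, Function.surjInv_eq hψ] }
  map_one' := by
    ext m
    simp [Function.surjInv_eq hψ]
  map_mul' A B := by
    ext m
    change ψ ((A.1 * B.1) *ᵥ _) = ψ (A.1 *ᵥ _)
    rw [← mulVec_mulVec]
    apply map_mulVec_eq_of_map_eq hker A.2
    rw [Function.surjInv_eq hψ]
    rfl

theorem orderToEnd_apply (hρ : Function.Surjective ρ) (hψ : Function.Surjective ψ)
    (hker : ∀ v, ψ v = 0 ↔ ∀ i, g i ∣ v i) (A : latticeOrder g) (v : ι → S) :
    orderToEnd hρ hψ hker A (ψ v) = ψ (A.1 *ᵥ v) := by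
  apply map_mulVec_eq_of_map_eq hker A.2
  rw [Function.surjInv_eq hψ]

theorem orderToEnd_surjective (hρ : Function.Surjective ρ) (hψ : Function.Surjective ψ)
    (hker : ∀ v, ψ v = 0 ↔ ∀ i, g i ∣ v i) :
    Function.Surjective (orderToEnd hρ hψ hker) := by
  intro e
  choose c hc using fun j : ι => hψ (e (ψ (Pi.single j 1)))
  -- The columns of `A` are preimages of the images of the generators.
  let A : Matrix ι ι S := of fun i j => c j i
  have hA : ∀ v, ψ (A *ᵥ v) = e (ψ v) := by
    intro v
    have h1 : A *ᵥ v = ∑ j, v j • c j := by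
      ext i
      simp [A, mulVec, dotProduct, mul_comm]
    have h2 : v = ∑ j, v j • Pi.single j (1 : S) := pi_eq_sum_univ' v
    conv_rhs => rw [h2]
    rw [h1, map_sum, map_sum, map_sum]
    refine Finset.sum_congr rfl fun j _ => ?_
    rw [map_smulₛₗ, map_smulₛₗ, hc, map_smul]
  have hmem : A ∈ latticeOrder g := by
    intro i j
    have h : ψ (Pi.single j (g j)) = 0 := by
      rw [hker]
      intro k
      rcases eq_or_ne k j with rfl | hk
      · simp
      · simp [hk]
    have := hA (Pi.single j (g j))
    rw [h, map_zero, hker] at this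
    simpa using this i
  refine ⟨⟨A, hmem⟩, ?_⟩
  ext m
  obtain ⟨v, rfl⟩ := hψ m
  rw [orderToEnd_apply, hA]

theorem orderToEnd_eq_one_iff (hρ : Function.Surjective ρ) (hψ : Function.Surjective ψ)
    (hker : ∀ v, ψ v = 0 ↔ ∀ i, g i ∣ v i) (A : latticeOrder g) :
    orderToEnd hρ hψ hker A = 1 ↔ ∀ i j, g i ∣ (A.1 - 1) i j := by
  have h1 : orderToEnd hρ hψ hker A = 1 ↔ ∀ v i, g i ∣ ((A.1 - 1) *ᵥ v) i := by
    constructor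
    · intro h v
      rw [← hker, sub_mulVec, map_sub, one_mulVec, sub_eq_zero, ← orderToEnd_apply hρ hψ hker, h]
      rfl
    · intro h
      ext m
      obtain ⟨v, rfl⟩ := hψ m
      rw [orderToEnd_apply, Module.End.one_apply, ← sub_eq_zero, ← map_sub, hker]
      simpa [sub_mulVec] using h v
  rw [h1]
  constructor
  · intro h i j
    simpa using h (Pi.single j 1) i
  · intro h v i
    exact Finset.dvd_sum fun j _ => (h i j).mul_right _

variable [IsLocalRing S]

/-- If the `gᵢ` are not invertible, a matrix congruent to the identity modulo the `gᵢ` (row by row)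
is a unit of the order. -/
theorem isUnit_of_dvd_sub_one (hg : ∀ i, ¬ IsUnit (g i)) (A : latticeOrder g)
    (hA : ∀ i j, g i ∣ (A.1 - 1) i j) : IsUnit A := by
  have hdet : IsUnit A.1.det := by
    have : (IsLocalRing.residue S) A.1.det = 1 := by
      rw [RingHom.map_det]
      have : (IsLocalRing.residue S).mapMatrix A.1 = 1 := by
        rw [← sub_eq_zero, ← map_one (IsLocalRing.residue S).mapMatrix, ← map_sub]
        ext i j
        rw [RingHom.mapMatrix_apply, map_apply, Matrix.zero_apply, IsLocalRing.residue_eq_zero_iff,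
          IsLocalRing.mem_maximalIdeal]
        exact fun h => hg i (isUnit_of_dvd_unit (hA i j) h)
      rw [this, det_one]
    exact (isUnit_map_iff (IsLocalRing.residue S) _).mp (this ▸ isUnit_one)
  have hinv : A.1⁻¹ ∈ latticeOrder g := by
    -- The second summand is divisible by `g i` in the `i`-th row, like `A - 1`.
    have : A.1⁻¹ = 1 - (A.1 - 1) * A.1⁻¹ := by
      rw [sub_mul, mul_nonsing_inv _ hdet, one_mul, sub_sub_cancel]
    rw [this]
    refine sub_mem (one_mem _) fun i j => Dvd.dvd.mul_right ?_ _
    exact Finset.dvd_sum fun k _ => (hA i k).mul_right _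
  exact .of_mul_eq_one ⟨A.1⁻¹, hinv⟩ (Subtype.ext (mul_nonsing_inv _ hdet))

/-- Automorphisms of `M` lift to units of the order. -/
theorem exists_unit_orderToEnd_eq (hρ : Function.Surjective ρ) (hψ : Function.Surjective ψ)
    (hker : ∀ v, ψ v = 0 ↔ ∀ i, g i ∣ v i) (hg : ∀ i, ¬ IsUnit (g i)) (e : (Module.End R M)ˣ) :
    ∃ A : (latticeOrder g)ˣ, Units.map (orderToEnd hρ hψ hker) A = e := by
  obtain ⟨A, hA⟩ := orderToEnd_surjective hρ hψ hker (e : Module.End R M)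
  obtain ⟨B, hB⟩ := orderToEnd_surjective hρ hψ hker (↑e⁻¹ : Module.End R M)
  have hAB : IsUnit (A * B) := isUnit_of_dvd_sub_one hg _ <|
    (orderToEnd_eq_one_iff hρ hψ hker _).mp (by rw [map_mul, hA, hB, Units.mul_inv])
  have hBA : IsUnit (B * A) := isUnit_of_dvd_sub_one hg _ <|
    (orderToEnd_eq_one_iff hρ hψ hker _).mp (by rw [map_mul, hA, hB, Units.inv_mul])
  have : IsUnit A := by
    obtain ⟨c, hc⟩ := hAB.exists_right_inv
    obtain ⟨d, hd⟩ := hBA.exists_left_inv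
    exact isUnit_iff_exists_and_exists.mpr ⟨⟨B * c, by rw [← mul_assoc, hc]⟩,
      ⟨d * B, by rw [mul_assoc, hd]⟩⟩
  obtain ⟨A', rfl⟩ := this
  exact ⟨A', Units.ext hA⟩

end Action

/-! ### Chains of divisors -/

section Chain

variable {S : Type*} [CommRing S] {n : ℕ}

/-- The chain `f₀ ∣ f₀f₁ ∣ f₀f₁f₂ ∣ ⋯` of partial products. -/
def partialProd (f : Fin n → S) (i : Fin n) : S := ∏ j ∈ Iic i, f j

variable {f : Fin n → S}

theorem partialProd_mul_prod_Ioc {i j : Fin n} (h : i ≤ j) :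
    partialProd f i * ∏ k ∈ Ioc i j, f k = partialProd f j := by
  rw [partialProd, partialProd, ← Finset.prod_union]
  · congr 1
    ext k
    simp only [mem_union, mem_Iic, mem_Ioc]
    grind
  · rw [Finset.disjoint_left]
    intro k
    simp only [mem_Iic, mem_Ioc]
    grind

theorem dvd_partialProd {i j : Fin n} (h : j ≤ i) : f j ∣ partialProd f i :=
  Finset.dvd_prod_of_mem f (mem_Iic.mpr h)

variable [IsDomain S]

/-- In a matrix `A` preserving `⊕ f₀⋯fᵢS`, an entry `A i j` below the diagonal is divisible by
`f_{j+1}⋯f_i`, hence by each of these factors. -/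
theorem dvd_of_mem_latticeOrder (hf : ∀ i, f i ≠ 0) {A : Matrix (Fin n) (Fin n) S}
    (hA : A ∈ latticeOrder (partialProd f)) {i j k : Fin n} (hjk : j < k) (hki : k ≤ i) :
    f k ∣ A i j := by
  have h := hA i j
  rw [← partialProd_mul_prod_Ioc (hjk.le.trans hki), mul_comm] at h
  have h0 : partialProd f j ≠ 0 := Finset.prod_ne_zero_iff.mpr fun a _ => hf a
  exact (Finset.dvd_prod_of_mem f (mem_Ioc.mpr ⟨hjk, hki⟩)).trans
    ((mul_dvd_mul_iff_right h0).mp h)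

/-- For a matrix `A` preserving `⊕ f₀⋯fᵢS`, the determinant modulo `f_j` of the block of `A` with
row and column indices `≥ j`. It is multiplicative because modulo `f_j` the entries to the left of
this block vanish. -/
def cornerDet (hf : ∀ i, f i ≠ 0) (j : Fin n) :
    latticeOrder (partialProd f) →* S ⧸ Ideal.span {f j} where
  toFun A := ((A.1.toBlock (j ≤ ·) (j ≤ ·)).map (Ideal.Quotient.mk (Ideal.span {f j}))).det
  map_one' := by
    have : (1 : latticeOrder (partialProd f)).1 = (1 : Matrix (Fin n) (Fin n) S) := rfl
    rw [this, toBlock_one_self, Matrix.map_one _ (map_zero _) (map_one _), det_one]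
  map_mul' A B := by
    have : (A * B).1 = A.1 * B.1 := rfl
    rw [this, toBlock_mul_eq_add (j ≤ ·) (j ≤ ·) (j ≤ ·), Matrix.map_add _ (map_add _), Matrix.map_mul,
      Matrix.map_mul, ← det_mul]
    have h0 : (A.1.toBlock (j ≤ ·) (fun i => ¬ j ≤ i)).map (Ideal.Quotient.mk (Ideal.span {f j})) =
        0 := by
      ext a b
      exact Ideal.Quotient.eq_zero_iff_dvd _ _ |>.mpr
        (dvd_of_mem_latticeOrder hf A.2 (not_le.mp b.2) a.2)
    rw [h0, Matrix.zero_mul, add_zero]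

theorem cornerDet_diagonalUnits (hf : ∀ i, f i ≠ 0) (j : Fin n) (s : Fin n → Sˣ) :
    cornerDet hf j (diagonalUnits (partialProd f) s : latticeOrder (partialProd f)) =
      Ideal.Quotient.mk (Ideal.span {f j}) (∏ a ∈ Ici j, s a : Sˣ) := by
  change ((toBlock (diagonal _) (j ≤ ·) (j ≤ ·)).map _).det = _
  rw [toBlock_diagonal_self, diagonal_map (map_zero _), det_diagonal, Units.coe_prod, map_prod]
  exact (Finset.prod_subtype (Ici j) (fun _ => mem_Ici)
    (fun a => Ideal.Quotient.mk (Ideal.span {f j}) (s a : S))).symm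

theorem cornerDet_eq_one (hf : ∀ i, f i ≠ 0) (A : latticeOrder (partialProd f))
    (hA : ∀ i j, partialProd f i ∣ (A.1 - 1) i j) (j : Fin n) : cornerDet hf j A = 1 := by
  have : (A.1.toBlock (j ≤ ·) (j ≤ ·)).map (Ideal.Quotient.mk (Ideal.span {f j})) = 1 := by
    rw [← Matrix.map_one _ (map_zero (Ideal.Quotient.mk (Ideal.span {f j}))) (map_one _),
      ← toBlock_one_self]
    ext a b
    rw [map_apply, map_apply, ← sub_eq_zero, ← map_sub, Ideal.Quotient.eq_zero_iff_dvd]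
    exact (dvd_partialProd a.2).trans (hA a b)
  change Matrix.det _ = 1
  rw [this, det_one]

/-- The diagonal entries of units of the order are invertible, since modulo the maximal ideal the
matrices in the order are upper triangular. -/
theorem isUnit_apply_self [IsLocalRing S] (hf : ∀ i, f i ≠ 0) (hfu : ∀ i, ¬ IsUnit (f i))
    (A : (latticeOrder (partialProd f))ˣ) (p : Fin n) :
    IsUnit ((A : latticeOrder (partialProd f)).1 p p) := by
  have hdet : IsUnit (A : latticeOrder (partialProd f)).1.det :=
    (isUnit_iff_isUnit_det _).mp (A.isUnit.map (latticeOrder (partialProd f)).val)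
  have h := hdet.map (IsLocalRing.residue S)
  rw [RingHom.map_det, det_of_isUpperTriangular, IsUnit.prod_univ_iff] at h
  · exact (isUnit_map_iff (IsLocalRing.residue S) _).mp (h p)
  · intro i j hij
    rw [RingHom.mapMatrix_apply, map_apply, IsLocalRing.residue_eq_zero_iff,
      IsLocalRing.mem_maximalIdeal]
    exact fun h => hfu i (isUnit_of_dvd_unit
      (dvd_of_mem_latticeOrder hf (A : latticeOrder (partialProd f)).2 hij le_rfl) h)

end Chain

/-! ### The abelianized automorphism group -/

section Main

variable {S : Type*} [CommRing S] {n : ℕ} {f : Fin (n + 1) → S}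

/-- If `s ≡ 1` modulo `f_{j+1}`, then the diagonal matrices with entry `s` at the position `j`,
respectively `j + 1`, agree in every commutative quotient of the unit group. -/
theorem map_mulSingle_succ_eq {Q : Type*} [CommGroup Q]
    (π : (latticeOrder (partialProd f))ˣ →* Q) (j : Fin n) (s : Sˣ)
    (hs : f j.succ ∣ (s : S) - 1) :
    π (diagonalUnits _ (Pi.mulSingle j.castSucc s)) =
      π (diagonalUnits _ (Pi.mulSingle j.succ s)) := by
  have hne : j.castSucc ≠ j.succ := (Fin.castSucc_lt_succ).ne
  have hg : partialProd f j.succ = partialProd f j.castSucc * f j.succ := by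
    rw [← partialProd_mul_prod_Ioc (Fin.castSucc_lt_succ (i := j)).le]
    congr 1
    have : Ioc j.castSucc j.succ = {j.succ} := by
      ext k
      simp only [mem_Ioc, mem_singleton, Fin.lt_def, Fin.le_def, Fin.ext_iff, Fin.val_castSucc,
        Fin.val_succ]
      omega
    rw [this, Finset.prod_singleton]
  have he : Matrix.single j.castSucc j.succ (1 : S) ∈ latticeOrder (partialProd f) := by
    intro a b
    rw [single_apply]
    split_ifs with h
    · rw [← h.1, ← h.2, hg, one_mul]
      exact dvd_mul_right _ _
    · simp
  have hf : Matrix.single j.succ j.castSucc ((s : S) - 1) ∈ latticeOrder (partialProd f) := by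
    intro a b
    rw [single_apply]
    split_ifs with h
    · rw [← h.1, ← h.2, hg, mul_comm ((s : S) - 1)]
      exact mul_dvd_mul_left _ hs
    · simp
  have hdiag : ∀ i : Fin (n + 1), (diagonal fun k => ((Pi.mulSingle i s : _ → Sˣ) k : S)) =
      1 + Matrix.single i i ((s : S) - 1) := by
    intro i
    rw [← diagonal_single, ← diagonal_one, diagonal_add]
    congr 1
    ext k
    rcases eq_or_ne k i with rfl | hk
    · simp
    · simp [hk]
  refine map_one_add_mul_comm π (e := ⟨_, he⟩) (f := ⟨_, hf⟩) ?_ ?_ _ _ ?_ ?_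
  · exact Subtype.ext (single_mul_single_of_ne _ _ _ _ hne.symm _)
  · exact Subtype.ext (single_mul_single_of_ne _ _ _ _ hne _)
  · refine Subtype.ext ?_
    rw [coe_diagonalUnits, hdiag]
    change _ = 1 + single _ _ _ * single _ _ _
    rw [single_mul_single_same, one_mul]
  · refine Subtype.ext ?_
    rw [coe_diagonalUnits, hdiag]
    change _ = 1 + single _ _ _ * single _ _ _
    rw [single_mul_single_same, mul_one]

/-- Let `S` be a local domain whose residue field has more than two elements, `f₀, …, fₙ` nonzero
non-units of `S`, and `M` the direct sum of the modules `S / f₀⋯fᵢS`. Then the abelianization of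
`Aut M` is the product of the unit groups of the rings `S / fᵢS`.

The direct sum is presented by a surjection `ψ` from `S^(n+1)` with kernel `⊕ f₀⋯fᵢS`, and `M` is
regarded as a module over some quotient `R` of `S`. -/
theorem nonempty_autAb_mulEquiv {R M : Type*} [IsDomain S] [IsLocalRing S] [Ring R]
    [AddCommGroup M] [Module R M] {u : Sˣ} (hu : IsUnit ((u : S) - 1)) (hf : ∀ i, f i ≠ 0)
    (hfu : ∀ i, ¬ IsUnit (f i)) {ρ : S →+* R} (hρ : Function.Surjective ρ)
    {ψ : (Fin (n + 1) → S) →ₛₗ[ρ] M} (hψ : Function.Surjective ψ)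
    (hker : ∀ v, ψ v = 0 ↔ ∀ i, (∏ j ∈ Iic i, f j) ∣ v i) :
    Nonempty (AutAb R M ≃* ∀ i, (S ⧸ Ideal.span {f i})ˣ) := by
  change ∀ v, ψ v = 0 ↔ ∀ i, partialProd f i ∣ v i at hker
  have hgu : ∀ i, ¬ IsUnit (partialProd f i) := fun i h =>
    hfu i (isUnit_of_dvd_unit (dvd_partialProd le_rfl) h)
  let φ : (latticeOrder (partialProd f))ˣ →* (M ≃ₗ[R] M) :=
    (LinearMap.GeneralLinearGroup.generalLinearEquiv R M).toMonoidHom.comp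
      (Units.map (orderToEnd hρ hψ hker))
  have hφ_one : ∀ A, φ A = 1 ↔
      ∀ i j, partialProd f i ∣ ((A : latticeOrder (partialProd f)).1 - 1) i j := by
    intro A
    rw [← orderToEnd_eq_one_iff hρ hψ hker]
    refine Iff.trans ?_ (Units.val_inj (a := Units.map (orderToEnd hρ hψ hker) A) (b := 1)).symm
    exact MulEquiv.map_eq_one_iff (LinearMap.GeneralLinearGroup.generalLinearEquiv R M)
  let D : (latticeOrder (partialProd f))ˣ →* ∀ i, (S ⧸ Ideal.span {f i})ˣ :=
    MonoidHom.pi fun j => Units.map (cornerDet hf j)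
  have hD : ∀ s j, (D (diagonalUnits _ s) j : S ⧸ Ideal.span {f j}) =
      Ideal.Quotient.mk (Ideal.span {f j}) (∏ a ∈ Ici j, s a : Sˣ) :=
    fun s j => cornerDet_diagonalUnits hf j s
  have hlift : ∀ j, Function.Surjective
      (Units.map (Ideal.Quotient.mk (Ideal.span {f j})).toMonoidHom) := by
    intro j
    have : IsLocalHom (Ideal.Quotient.mk (Ideal.span {f j})) := by
      refine ⟨fun a ha => ?_⟩
      obtain ⟨b, hb⟩ := ha.exists_right_inv
      obtain ⟨b, rfl⟩ := Ideal.Quotient.mk_surjective b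
      rw [← map_mul, ← map_one (Ideal.Quotient.mk (Ideal.span {f j})), ← sub_eq_zero, ← map_sub,
        Ideal.Quotient.eq_zero_iff_dvd] at hb
      obtain ⟨c, hc⟩ := hb
      have h1 : a * b + f j * -c = 1 := by rw [mul_neg, ← hc]; ring
      rcases IsLocalRing.isUnit_or_isUnit_of_add_one h1 with h | h
      · exact isUnit_of_mul_isUnit_left h
      · exact absurd (isUnit_of_mul_isUnit_left h) (hfu j)
    exact IsLocalRing.surjective_units_map_of_local_ringHom _ Ideal.Quotient.mk_surjective this
  refine nonempty_abelianization_mulEquiv φ D ?_ ?_ ?_ ?_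
  · intro e
    obtain ⟨e, rfl⟩ := (LinearMap.GeneralLinearGroup.generalLinearEquiv R M).surjective e
    obtain ⟨A, rfl⟩ := exists_unit_orderToEnd_eq hρ hψ hker hgu e
    exact ⟨A, rfl⟩
  · intro t
    choose t' ht' using fun j => hlift j (t j)
    obtain ⟨s, hs⟩ := Fin.exists_prod_Ici_eq t'
    refine ⟨diagonalUnits _ s, funext fun j => Units.ext ?_⟩
    rw [hD, hs, ← ht']
    rfl
  · intro A hA
    rw [MonoidHom.mem_ker, hφ_one] at hA
    exact funext fun j => Units.ext (cornerDet_eq_one hf _ hA j)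
  · intro A hA
    let π := (Abelianization.of (G := M ≃ₗ[R] M)).comp φ
    -- Eliminating with respect to `D` as well keeps the diagonal matrix in the kernel of `D`.
    obtain ⟨s, hs⟩ := exists_map_diagonalUnits_eq (π.prod D) hu (isUnit_apply_self hf hfu) A
    obtain ⟨hπ, hDs⟩ := Prod.ext_iff.mp hs
    have hsf : ∀ j, f j ∣ ((∏ a ∈ Ici j, s a : Sˣ) : S) - 1 := by
      intro j
      rw [← Ideal.Quotient.eq_zero_iff_dvd, map_sub, ← hD, map_one, sub_eq_zero]
      exact congrArg Units.val (congrFun (hDs.trans hA) j)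
    have hprod := Fin.prod_hom_eq_hom_zero_prod
      (fun i => (π.comp (diagonalUnits (partialProd f))).comp (MonoidHom.mulSingle _ i)) s
      (fun j => (map_mulSingle_succ_eq π j _ (hsf j.succ)).symm)
    have h0 : ∏ a ∈ Ici 0, s a = ∏ a, s a := by
      congr 1
      ext
      simp
    refine (hπ.symm.trans ((map_diagonalUnits π s).trans hprod)).trans ?_
    have : φ (diagonalUnits (partialProd f) (Pi.mulSingle 0 (∏ a, s a))) = 1 := by
      rw [hφ_one]
      intro i j
      rw [coe_diagonalUnits, ← diagonal_one, diagonal_sub, diagonal_apply]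
      split_ifs with h
      · rcases eq_or_ne i 0 with rfl | hi
        · have := hsf 0
          rw [h0] at this
          have hI : Iic (0 : Fin (n + 1)) = {0} := by
            ext
            simp
          simpa [partialProd, hI] using this
        · simp [hi]
      · exact dvd_zero _
    exact (congrArg Abelianization.of this).trans (map_one _)

end Main

end

/-! ### Smooth branches in the plane -/

section PowerSeries

open PlaneCurve

variable {k : Type*} [Field k]

/-- The homomorphism `k[[x, y]] → k[[X]]` sending the variable with index `s` to `X` and the other
one to zero. -/
noncomputable def restrictAxis (s : Fin 2) : PS k →+* PowerSeries k where
  toFun F := PowerSeries.mk fun n => MvPowerSeries.coeff (Finsupp.single s n) F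
  map_one' := by
    classical
    ext n
    simp [MvPowerSeries.coeff_one, PowerSeries.coeff_one]
  map_zero' := by ext; simp
  map_add' F G := by ext; simp
  map_mul' F G := by
    classical
    ext n
    rw [PowerSeries.coeff_mk, PowerSeries.coeff_mul, MvPowerSeries.coeff_mul,
      Finsupp.antidiagonal_single, Finset.sum_map]
    simp

theorem restrictAxis_surjective (s : Fin 2) : Function.Surjective (restrictAxis (k := k) s) := by
  intro F
  let G : PS k := fun m => PowerSeries.coeff (m s) F
  refine ⟨G, PowerSeries.ext fun n => ?_⟩
  change PowerSeries.coeff n (PowerSeries.mk fun n => G (Finsupp.single s n)) = _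
  simp only [PowerSeries.coeff_mk, G, Finsupp.single_eq_same]

theorem ker_restrictAxis {s t : Fin 2} (h : s ≠ t) :
    RingHom.ker (restrictAxis (k := k) s) = Ideal.span {MvPowerSeries.X t} := by
  ext F
  rw [RingHom.mem_ker, Ideal.mem_span_singleton, MvPowerSeries.X_dvd_iff]
  constructor
  · intro hF m hm
    have : m = Finsupp.single s (m s) := by
      ext i
      rcases eq_or_ne i s with rfl | hi
      · simp
      · have : i = t := by omega
        rw [this, hm, Finsupp.single_eq_of_ne h.symm]
    rw [this]
    have := congrArg (PowerSeries.coeff (m s)) hF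
    simpa [restrictAxis] using this
  · intro hF
    ext n
    have := hF (Finsupp.single s n) (Finsupp.single_eq_of_ne h.symm)
    simpa [restrictAxis] using this

/-- The quotient of `k[[x, y]]` by one of the variables is `k[[X]]`. -/
noncomputable def quoXEquiv {s t : Fin 2} (h : s ≠ t) :
    Quo (MvPowerSeries.X t : PS k) ≃+* PowerSeries k :=
  (Ideal.quotEquivOfEq (ker_restrictAxis h).symm).trans
    (RingHom.quotientKerEquivOfSurjective (restrictAxis_surjective s))

/-- The images `x ↦ x + cyⁿ`, `y ↦ y` of the variables under a change of coordinates. -/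
noncomputable def shearVars (n : ℕ) (c : k) : Fin 2 → PS k := ![x k + c • y k ^ n, y k]

theorem hasSubst_shearVars {n : ℕ} (hn : n ≠ 0) (c : k) :
    MvPowerSeries.HasSubst (shearVars n c) := by
  refine MvPowerSeries.hasSubst_of_constantCoeff_zero fun i => ?_
  fin_cases i
  · simp [shearVars, hn]
  · simp [shearVars]

theorem shear_comp_shear {n : ℕ} (hn : n ≠ 0) {c d : k} (h : c + d = 0) :
    (MvPowerSeries.substAlgHom (R := k) (hasSubst_shearVars hn d)).comp
      (MvPowerSeries.substAlgHom (hasSubst_shearVars hn c)) = AlgHom.id k (PS k) := by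
  have key : (fun i => MvPowerSeries.substAlgHom (R := k) (hasSubst_shearVars hn d)
      (shearVars n c i)) = MvPowerSeries.X := by
    have hx : MvPowerSeries.substAlgHom (R := k) (hasSubst_shearVars hn d) (x k) =
        x k + d • y k ^ n := MvPowerSeries.substAlgHom_X _ 0
    have hy : MvPowerSeries.substAlgHom (R := k) (hasSubst_shearVars hn d) (y k) = y k :=
      MvPowerSeries.substAlgHom_X _ 1
    ext1 i
    fin_cases i
    · change MvPowerSeries.substAlgHom _ (x k + c • y k ^ n) = x k
      rw [map_add, map_smul, map_pow, hx, hy, add_assoc, ← add_smul, add_comm d, h, zero_smul,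
        add_zero]
    · exact hy
  ext1 F
  rw [AlgHom.comp_apply, MvPowerSeries.substAlgHom_comp_substAlgHom_apply,
    MvPowerSeries.substAlgHom_apply]
  conv_lhs => rw [key, MvPowerSeries.subst_self]
  rfl

/-- The change of coordinates `x ↦ x + cyⁿ`, `y ↦ y` of `k[[x, y]]`. -/
noncomputable def shear {n : ℕ} (hn : n ≠ 0) (c : k) : PS k ≃ₐ[k] PS k :=
  AlgEquiv.ofAlgHom (MvPowerSeries.substAlgHom (hasSubst_shearVars hn c))
    (MvPowerSeries.substAlgHom (hasSubst_shearVars hn (-c)))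
    (shear_comp_shear hn (neg_add_cancel c)) (shear_comp_shear hn (add_neg_cancel c))

/-- The smooth branch `x + cyⁿ = 0` has coordinate ring `k[[X]]`. -/
noncomputable def quoBranchEquiv {n : ℕ} (hn : n ≠ 0) (c : k) :
    Quo (x k + c • y k ^ n) ≃+* PowerSeries k :=
  (Ideal.quotientEquiv (Ideal.span {MvPowerSeries.X 0}) _ (shear hn c).toRingEquiv (by
    rw [Ideal.map_span, Set.image_singleton]
    congr 2
    exact (MvPowerSeries.substAlgHom_X (hasSubst_shearVars hn c) 0).symm)).symm.trans
  (quoXEquiv (s := 1) (t := 0) (by decide))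

theorem not_isUnit_branch {n : ℕ} (hn : n ≠ 0) (c : k) : ¬ IsUnit (x k + c • y k ^ n) := by
  rw [MvPowerSeries.isUnit_iff_constantCoeff]
  simp [hn]

theorem X_ne_zero (i : Fin 2) : (MvPowerSeries.X i : PS k) ≠ 0 := by
  classical
  intro h
  simpa [MvPowerSeries.coeff_X] using congrArg (MvPowerSeries.coeff (Finsupp.single i 1)) h

theorem branch_ne_zero {n : ℕ} (hn : n ≠ 0) (c : k) : x k + c • y k ^ n ≠ 0 := by
  intro h
  have : x k = 0 := (shear hn c).injective (by
    rw [map_zero, ← h]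
    exact MvPowerSeries.substAlgHom_X (hasSubst_shearVars hn c) 0)
  exact X_ne_zero 0 this

theorem add_one_smul_pow (n : ℕ) : x k + (1 : k) • y k ^ n = x k + y k ^ n := by rw [one_smul]

theorem add_neg_one_smul_pow (n : ℕ) : x k + (-1 : k) • y k ^ n = x k - y k ^ n := by
  rw [neg_one_smul, sub_eq_add_neg]

theorem exists_unit_sub_one [Infinite k] : ∃ u : (PS k)ˣ, IsUnit ((u : PS k) - 1) := by
  classical
  obtain ⟨a, ha⟩ := Infinite.exists_notMem_finset ({0, 1} : Finset k)
  simp only [Finset.mem_insert, Finset.mem_singleton, not_or] at ha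
  refine ⟨Units.map (algebraMap k (PS k)).toMonoidHom (Units.mk0 a ha.1), ?_⟩
  have := (IsUnit.mk0 _ (sub_ne_zero.mpr ha.2)).map (algebraMap k (PS k))
  rwa [map_sub, map_one] at this

end PowerSeries

/-! ### The singularities of types `A` and `D` -/

section Singularities

open PlaneCurve

variable {k : Type*} [Field k]

/-- The presentation of `S/(x - yⁿ) ⊕ R` as a quotient of the free module of rank two. -/
noncomputable def presentationA (n : ℕ) :
    (Fin 2 → PS k) →ₛₗ[Ideal.Quotient.mk (Ideal.span {eqA k n})] LA k n where
  toFun v := (Ideal.Quotient.mk (Ideal.span {x k - y k ^ n}) (v 0), Ideal.Quotient.mk _ (v 1))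
  map_add' _ _ := rfl
  map_smul' _ _ := rfl

theorem presentationA_surjective (n : ℕ) : Function.Surjective (presentationA (k := k) n) := by
  rintro ⟨a, b⟩
  obtain ⟨a, rfl⟩ := Ideal.Quotient.mk_surjective (I := Ideal.span {x k - y k ^ n}) a
  obtain ⟨b, rfl⟩ := Ideal.Quotient.mk_surjective b
  exact ⟨![a, b], rfl⟩

theorem presentationA_eq_zero_iff (n : ℕ) (v : Fin 2 → PS k) : presentationA n v = 0 ↔
    ∀ i, (∏ j ∈ Finset.Iic i, ![x k - y k ^ n, x k + y k ^ n] j) ∣ v i := by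
  have h0 : Finset.Iic (0 : Fin 2) = {0} := by decide
  have h1 : Finset.Iic (1 : Fin 2) = {0, 1} := by decide
  rw [Fin.forall_fin_two, h0, h1, Finset.prod_singleton, Finset.prod_pair (by decide)]
  refine Prod.ext_iff.trans (and_congr ?_ ?_)
  · exact Ideal.Quotient.eq_zero_iff_dvd _ _
  · exact Ideal.Quotient.eq_zero_iff_dvd _ _

/-- The presentation of `S/(x - yⁿ⁻¹) ⊕ S/((x - yⁿ⁻¹)y) ⊕ R` as a quotient of the free module of
rank three. -/
noncomputable def presentationD (n : ℕ) :
    (Fin 3 → PS k) →ₛₗ[Ideal.Quotient.mk (Ideal.span {eqD k n})] LD k n where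
  toFun v := (Ideal.Quotient.mk (Ideal.span {x k - y k ^ (n - 1)}) (v 0),
    Ideal.Quotient.mk (Ideal.span {(x k - y k ^ (n - 1)) * y k}) (v 1), Ideal.Quotient.mk _ (v 2))
  map_add' _ _ := rfl
  map_smul' _ _ := rfl

theorem presentationD_surjective (n : ℕ) : Function.Surjective (presentationD (k := k) n) := by
  rintro ⟨a, b, c⟩
  obtain ⟨a, rfl⟩ := Ideal.Quotient.mk_surjective (I := Ideal.span {x k - y k ^ (n - 1)}) a
  obtain ⟨b, rfl⟩ :=
    Ideal.Quotient.mk_surjective (I := Ideal.span {(x k - y k ^ (n - 1)) * y k}) b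
  obtain ⟨c, rfl⟩ := Ideal.Quotient.mk_surjective c
  exact ⟨![a, b, c], rfl⟩

theorem presentationD_eq_zero_iff (n : ℕ) (v : Fin 3 → PS k) : presentationD n v = 0 ↔
    ∀ i, (∏ j ∈ Finset.Iic i, ![x k - y k ^ (n - 1), y k, x k + y k ^ (n - 1)] j) ∣ v i := by
  have h0 : Finset.Iic (0 : Fin 3) = {0} := by decide
  have h1 : Finset.Iic (1 : Fin 3) = {0, 1} := by decide
  have h2 : Finset.Iic (2 : Fin 3) = Finset.univ := by decide
  rw [Fin.forall_fin_succ, Fin.forall_fin_two]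
  change _ ↔ _ ∣ v 0 ∧ (∏ j ∈ Finset.Iic (1 : Fin 3), _) ∣ v 1 ∧
    (∏ j ∈ Finset.Iic (2 : Fin 3), _) ∣ v 2
  rw [h0, h1, h2, Finset.prod_singleton, Finset.prod_pair (by decide), Fin.prod_univ_three]
  refine Prod.ext_iff.trans (and_congr ?_ (Prod.ext_iff.trans (and_congr ?_ ?_)))
  · exact Ideal.Quotient.eq_zero_iff_dvd _ _
  · exact Ideal.Quotient.eq_zero_iff_dvd _ _
  · exact Ideal.Quotient.eq_zero_iff_dvd _ _

/-- `S/(x - yⁿ)` is a power series ring in one variable. -/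
noncomputable def quoSubEquiv {n : ℕ} (hn : n ≠ 0) : Quo (x k - y k ^ n) ≃+* PowerSeries k :=
  (Ideal.quotEquivOfEq (by rw [add_neg_one_smul_pow])).trans (quoBranchEquiv hn (-1))

/-- `S/(x + yⁿ)` is a power series ring in one variable. -/
noncomputable def quoAddEquiv {n : ℕ} (hn : n ≠ 0) : Quo (x k + y k ^ n) ≃+* PowerSeries k :=
  (Ideal.quotEquivOfEq (by rw [add_one_smul_pow])).trans (quoBranchEquiv hn 1)

theorem nonempty_autAb_A [Infinite k] {n : ℕ} (hn : n ≠ 0) :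
    Nonempty (AutAb (RA k n) (LA k n) ≃*
      (Quo (x k - y k ^ n))ˣ × (Quo (x k + y k ^ n))ˣ) := by
  obtain ⟨u, hu⟩ := exists_unit_sub_one (k := k)
  have : IsDomain (PS k) := NoZeroDivisors.to_isDomain _
  have hf : ∀ i, ![x k - y k ^ n, x k + y k ^ n] i ≠ 0 := by
    rw [Fin.forall_fin_two]
    exact ⟨add_neg_one_smul_pow (k := k) n ▸ branch_ne_zero hn (-1),
      add_one_smul_pow (k := k) n ▸ branch_ne_zero hn 1⟩
  have hfu : ∀ i, ¬ IsUnit (![x k - y k ^ n, x k + y k ^ n] i) := by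
    rw [Fin.forall_fin_two]
    exact ⟨add_neg_one_smul_pow (k := k) n ▸ not_isUnit_branch hn (-1),
      add_one_smul_pow (k := k) n ▸ not_isUnit_branch hn 1⟩
  obtain ⟨e⟩ := nonempty_autAb_mulEquiv hu hf hfu Ideal.Quotient.mk_surjective
    (presentationA_surjective n) (presentationA_eq_zero_iff n)
  exact ⟨e.trans
    { toFun := fun t => (t 0, t 1)
      invFun := fun t => Fin.cons t.1 (Fin.cons t.2 finZeroElim)
      left_inv := fun t => funext (Fin.forall_fin_two.mpr ⟨rfl, rfl⟩)
      right_inv := fun _ => rfl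
      map_mul' := fun _ _ => rfl }⟩

theorem nonempty_autAb_D [Infinite k] {n : ℕ} (hn : n - 1 ≠ 0) :
    Nonempty (AutAb (RD k n) (LD k n) ≃* (Quo (x k - y k ^ (n - 1)))ˣ × (Quo (y k))ˣ ×
      (Quo (x k + y k ^ (n - 1)))ˣ) := by
  obtain ⟨u, hu⟩ := exists_unit_sub_one (k := k)
  have : IsDomain (PS k) := NoZeroDivisors.to_isDomain _
  have hf : ∀ i, ![x k - y k ^ (n - 1), y k, x k + y k ^ (n - 1)] i ≠ 0 := by
    rw [Fin.forall_fin_succ, Fin.forall_fin_two]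
    exact ⟨add_neg_one_smul_pow (k := k) (n - 1) ▸ branch_ne_zero hn (-1), X_ne_zero 1,
      add_one_smul_pow (k := k) (n - 1) ▸ branch_ne_zero hn 1⟩
  have hfu : ∀ i, ¬ IsUnit (![x k - y k ^ (n - 1), y k, x k + y k ^ (n - 1)] i) := by
    rw [Fin.forall_fin_succ, Fin.forall_fin_two]
    refine ⟨add_neg_one_smul_pow (k := k) (n - 1) ▸ not_isUnit_branch hn (-1), ?_,
      add_one_smul_pow (k := k) (n - 1) ▸ not_isUnit_branch hn 1⟩
    change ¬ IsUnit (y k)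
    rw [MvPowerSeries.isUnit_iff_constantCoeff]
    simp
  obtain ⟨e⟩ := nonempty_autAb_mulEquiv hu hf hfu Ideal.Quotient.mk_surjective
    (presentationD_surjective n) (presentationD_eq_zero_iff n)
  exact ⟨e.trans
    { toFun := fun t => (t 0, t 1, t 2)
      invFun := fun t => Fin.cons t.1 (Fin.cons t.2.1 (Fin.cons t.2.2 finZeroElim))
      left_inv := fun t => funext (Fin.forall_fin_succ.mpr ⟨rfl, Fin.forall_fin_two.mpr ⟨rfl, rfl⟩⟩)
      right_inv := fun _ => rfl
      map_mul' := fun _ _ => rfl }⟩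

end Singularities

theorem corollary5p7 (k : Type*) [Field k] [IsAlgClosed k]
    (h2 : ringChar k ≠ 2) (h3 : ringChar k ≠ 3) (h5 : ringChar k ≠ 5) :
    (∀ n : ℕ, 1 ≤ n →
      Nonempty (AutAb (PlaneCurve.RA k n) (PlaneCurve.LA k n) ≃*
        (PlaneCurve.Quo (PlaneCurve.x k - PlaneCurve.y k ^ n))ˣ ×
        (PlaneCurve.Quo (PlaneCurve.x k + PlaneCurve.y k ^ n))ˣ) ∧
      Nonempty (AutAb (PlaneCurve.RA k n) (PlaneCurve.LA k n) ≃*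
        (PowerSeries k)ˣ × (PowerSeries k)ˣ)) ∧
    (∀ n : ℕ, 2 ≤ n →
      Nonempty (AutAb (PlaneCurve.RD k n) (PlaneCurve.LD k n) ≃*
        (PlaneCurve.Quo (PlaneCurve.x k - PlaneCurve.y k ^ (n - 1)))ˣ ×
        (PlaneCurve.Quo (PlaneCurve.y k))ˣ ×
        (PlaneCurve.Quo (PlaneCurve.x k + PlaneCurve.y k ^ (n - 1)))ˣ) ∧
      Nonempty (AutAb (PlaneCurve.RD k n) (PlaneCurve.LD k n) ≃*
        (PowerSeries k)ˣ × (PowerSeries k)ˣ × (PowerSeries k)ˣ)) := by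
  refine ⟨fun n hn => ?_, fun n hn => ?_⟩
  · have hn' : n ≠ 0 := by omega
    obtain ⟨e⟩ := nonempty_autAb_A (k := k) hn'
    exact ⟨⟨e⟩, ⟨e.trans ((Units.mapEquiv (quoSubEquiv hn').toMulEquiv).prodCongr
      (Units.mapEquiv (quoAddEquiv hn').toMulEquiv))⟩⟩
  · have hn' : n - 1 ≠ 0 := by omega
    obtain ⟨e⟩ := nonempty_autAb_D (k := k) hn'
    exact ⟨⟨e⟩, ⟨e.trans ((Units.mapEquiv (quoSubEquiv hn').toMulEquiv).prodCongr
      ((Units.mapEquiv (quoXEquiv (s := 0) (t := 1) (by decide)).toMulEquiv).prodCongr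
        (Units.mapEquiv (quoAddEquiv hn').toMulEquiv)))⟩⟩
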